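/- Let $\ell^{\infty}$ be the complex Banach space of bounded complex sequences on $\mathbb{N}$ with the supremum norm $\|\cdot\|_\infty$. An isometric Banach predual of a normed space $X$ is a pair $(Y,\varphi)$ of a Banach space $Y$ and an isometric (linear) isomorphism $\varphi\colon X\to Y^{*}$ onto the dual space $Y^*$ with the dual norm. The space $X$ is said to have a strongly unique isometric Banach predual if $X$ has an isometric Banach predual and, for all isometric Banach preduals $(Y,\varphi)$ and $(Z,\psi)$ of $X$ and every isometric isomorphism $\alpha\colon Z^{*}\to Y^{*}$, there is an isometric isomorphism $\lambda\colon Y\to Z$ such that $\lambda^{t}=\alpha$, where $\lambda^{t}(z^{*})=z^{*}\circ\lambda$ for $z^*\in Z^*$. Then $(\ell^{\infty},\|\cdot\|_\infty)$ has a strongly unique isometric Banach predual. -/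

import Mathlib

open scoped ENNReal

universe u v w

/-- The dual map `Tᵗ : Y* → X*`, `f ↦ f ∘ T`, of a continuous linear map `T : X → Y`. -/
noncomputable def strongDualMap {𝕜 : Type*} [RCLike 𝕜]
    {X : Type*} [NormedAddCommGroup X] [NormedSpace 𝕜 X]
    {Y : Type*} [NormedAddCommGroup Y] [NormedSpace 𝕜 Y] (T : X →L[𝕜] Y) :
    StrongDual 𝕜 Y →L[𝕜] StrongDual 𝕜 X :=
  ContinuousLinearMap.precomp 𝕜 T

theorem strongDualMap_apply {𝕜 : Type*} [RCLike 𝕜]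
    {X : Type*} [NormedAddCommGroup X] [NormedSpace 𝕜 X]
    {Y : Type*} [NormedAddCommGroup Y] [NormedSpace 𝕜 Y] (T : X →L[𝕜] Y)
    (f : StrongDual 𝕜 Y) (x : X) : strongDualMap T f x = f (T x) :=
  rfl

/-- `X` is an isometric dual Banach space: there are a Banach space `Y` and an isometric
isomorphism `φ : X → Y*`, i.e. an isometric Banach predual `(Y, φ)` of `X`. Since `Y` embeds into
the bidual of `Y`, hence into the dual of `X`, it is no restriction to look for `Y` in the
universe of `X`. -/
def IsIsometricDualBanachSpace (𝕜 : Type) [RCLike 𝕜]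
    (X : Type u) [NormedAddCommGroup X] [NormedSpace 𝕜 X] : Prop :=
  ∃ (Y : Type u) (_ : NormedAddCommGroup Y) (_ : NormedSpace 𝕜 Y) (_ : CompleteSpace Y),
    Nonempty (X ≃ₗᵢ[𝕜] StrongDual 𝕜 Y)

/-- `X` has a strongly unique isometric Banach predual: it is an isometric dual Banach space, and
for all isometric Banach preduals `(Y, φ)` and `(Z, ψ)` of `X` and all isometric isomorphisms
`α : Z* → Y*` there is an isometric isomorphism `l : Y → Z` whose dual map is `α`. The preduals
`Y` and `Z` range over all Banach spaces in two arbitrary universes. -/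
def HasStronglyUniqueIsometricBanachPredual (𝕜 : Type) [RCLike 𝕜]
    (X : Type u) [NormedAddCommGroup X] [NormedSpace 𝕜 X] : Prop :=
  IsIsometricDualBanachSpace 𝕜 X ∧
    ∀ (Y : Type v) [NormedAddCommGroup Y] [NormedSpace 𝕜 Y] [CompleteSpace Y]
      (Z : Type w) [NormedAddCommGroup Z] [NormedSpace 𝕜 Z] [CompleteSpace Z]
      (_φ : X ≃ₗᵢ[𝕜] StrongDual 𝕜 Y) (_ψ : X ≃ₗᵢ[𝕜] StrongDual 𝕜 Z)
      (α : StrongDual 𝕜 Z ≃ₗᵢ[𝕜] StrongDual 𝕜 Y),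
      ∃ l : Y ≃ₗᵢ[𝕜] Z,
        strongDualMap (l.toContinuousLinearEquiv : Y →L[𝕜] Z) =
          (α.toContinuousLinearEquiv : StrongDual 𝕜 Z →L[𝕜] StrongDual 𝕜 Y)

/-! Every isometric predual `Y` of `ℓ^∞` sits isometrically, as a closed subspace, in the dual of
`ℓ^∞`, and its image is always the closed span of the coordinate functionals `δ_i`. The reason is
the estimate `‖F - F(e_i) δ_i‖ ≤ ‖F‖ - |F(e_i)|`: an element of the unit ball of `Y` that almost
attains the norm of `e_i` is almost a multiple of `δ_i`, so `δ_i` lies in the image. Since the `δ_i`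
separate the points of `ℓ^∞ = Y*`, Hahn-Banach shows that they span a dense subspace of `Y`. The
preduals given by `ψ` and by `ψ` followed by `α` therefore have the same image, and identifying them
through it yields the map whose dual is `α`. -/

open Submodule in
/-- Hahn-Banach: a point off a closed subspace is separated from it by a functional. -/
theorem exists_strongDual_eq_zero_of_notMem {𝕜 E : Type*} [RCLike 𝕜] [NormedAddCommGroup E]
    [NormedSpace 𝕜 E] (M : Submodule 𝕜 E) (hM : IsClosed (M : Set E)) {y : E} (hy : y ∉ M) :
    ∃ f : StrongDual 𝕜 E, (∀ z ∈ M, f z = 0) ∧ f y ≠ 0 := by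
  have : IsClosed (M : Set E) := hM
  have hne : ‖M.mkQ y‖ ≠ 0 := by
    rwa [Ne, norm_eq_zero, mkQ_apply, Quotient.mk_eq_zero]
  obtain ⟨g, -, hg⟩ := exists_dual_vector 𝕜 (M.mkQ y) hne
  refine ⟨g.comp (M.mkQ.mkContinuous 1 fun z => ?_), fun z hz => ?_, ?_⟩
  · rw [one_mul]
    exact Quotient.norm_mk_le M z
  · simp [(Quotient.mk_eq_zero M).2 hz]
  · change g (M.mkQ y) ≠ 0
    rw [hg]
    exact_mod_cast hne

theorem exists_norm_add_mul_eq {𝕜 : Type*} [RCLike 𝕜] (c d : 𝕜) :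
    ∃ θ : 𝕜, ‖θ‖ = 1 ∧ ‖c + θ * d‖ = ‖c‖ + ‖d‖ := by
  by_cases hc : c = 0
  · exact ⟨1, by simp, by simp [hc]⟩
  by_cases hd : d = 0
  · exact ⟨1, by simp, by simp [hd]⟩
  have hc' : (‖c‖ : 𝕜) ≠ 0 := by simpa using hc
  have hd' : (‖d‖ : 𝕜) ≠ 0 := by simpa using hd
  refine ⟨c / ‖c‖ * (‖d‖ / d), by simp [hc, hd], ?_⟩
  have : c + c / ‖c‖ * (‖d‖ / d) * d = c / ‖c‖ * ((‖c‖ + ‖d‖ : ℝ) : 𝕜) := by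
    push_cast
    field_simp
  rw [this, norm_mul, RCLike.norm_ofReal, abs_of_nonneg (by positivity)]
  simp [hc]

section Coordinates

variable {ι : Type*}

/-- The coordinate functional `x ↦ x i` on `ℓ^∞(ι)`. -/
noncomputable def linftyCoord (i : ι) : StrongDual ℂ (lp (fun _ : ι => ℂ) ∞) :=
  LinearMap.mkContinuous
    { toFun := fun x => x i
      map_add' := fun _ _ => rfl
      map_smul' := fun _ _ => rfl } 1 fun x => by
    rw [one_mul]
    exact lp.norm_apply_le_norm ENNReal.top_ne_zero x i

@[simp]
theorem linftyCoord_apply (i : ι) (x : lp (fun _ : ι => ℂ) ∞) : linftyCoord i x = x i :=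
  rfl

variable (ι) in
/-- The closed linear span of the coordinate functionals in the dual of `ℓ^∞(ι)`. -/
noncomputable def coordSpan : Submodule ℂ (StrongDual ℂ (lp (fun _ : ι => ℂ) ∞)) :=
  (Submodule.span ℂ (Set.range linftyCoord)).topologicalClosure

theorem linftyCoord_mem_coordSpan (i : ι) : linftyCoord i ∈ coordSpan ι :=
  Submodule.le_topologicalClosure _ (Submodule.subset_span ⟨i, rfl⟩)

theorem norm_linftyCoord_le (i : ι) : ‖linftyCoord i‖ ≤ 1 :=
  LinearMap.mkContinuous_norm_le _ zero_le_one _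

/-- The vectors `‖x‖ e_i` and `θ x` have disjoint supports, so their sum has norm at most `‖x‖`; a
unimodular `θ` aligning the phases makes the moduli of their values under `F` add up. -/
theorem norm_apply_le_of_apply_eq_zero [DecidableEq ι]
    (F : StrongDual ℂ (lp (fun _ : ι => ℂ) ∞)) (i : ι)
    (x : lp (fun _ : ι => ℂ) ∞) (hx : x i = 0) :
    ‖F x‖ ≤ (‖F‖ - ‖F (lp.single ∞ i 1)‖) * ‖x‖ := by
  obtain ⟨θ, hθ, hsum⟩ := exists_norm_add_mul_eq ((‖x‖ : ℂ) * F (lp.single ∞ i 1)) (F x)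
  have hle : ‖(‖x‖ : ℂ) • lp.single ∞ i (1 : ℂ) + θ • x‖ ≤ ‖x‖ := by
    refine lp.norm_le_of_forall_le (norm_nonneg x) fun j => ?_
    rw [lp.coeFn_add, Pi.add_apply, lp.coeFn_smul, lp.coeFn_smul, Pi.smul_apply, Pi.smul_apply]
    by_cases hj : j = i
    · subst hj
      simp [hx]
    · rw [lp.single_apply_ne _ _ _ hj, smul_zero, zero_add, norm_smul, hθ, one_mul]
      exact lp.norm_apply_le_norm ENNReal.top_ne_zero x j
  have hF := F.le_opNorm_of_le hle
  rw [map_add, map_smul, map_smul, smul_eq_mul, smul_eq_mul, hsum, norm_mul, Complex.norm_real,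
    norm_norm] at hF
  linarith

/-- The left-hand functional is `F` evaluated after deleting the `i`-th coordinate, which does not
increase the sup norm. -/
theorem norm_sub_smul_linftyCoord_le [DecidableEq ι]
    (F : StrongDual ℂ (lp (fun _ : ι => ℂ) ∞)) (i : ι) :
    ‖F - F (lp.single ∞ i 1) • linftyCoord i‖ ≤ ‖F‖ - ‖F (lp.single ∞ i 1)‖ := by
  have h0 : 0 ≤ ‖F‖ - ‖F (lp.single ∞ i 1)‖ := by
    have := F.le_opNorm (lp.single ∞ i 1)
    rw [lp.norm_single ENNReal.zero_lt_top, norm_one, mul_one] at this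
    linarith
  refine ContinuousLinearMap.opNorm_le_bound _ h0 fun x => ?_
  have hval : (F - F (lp.single ∞ i 1) • linftyCoord i) x = F (x - x i • lp.single ∞ i 1) := by
    simp [mul_comm]
  rw [hval]
  refine (norm_apply_le_of_apply_eq_zero F i _ ?_).trans (mul_le_mul_of_nonneg_left ?_ h0)
  · rw [lp.coeFn_sub, Pi.sub_apply, lp.coeFn_smul, Pi.smul_apply, lp.single_apply_self]
    simp
  · refine lp.norm_le_of_forall_le (norm_nonneg x) fun j => ?_
    rw [lp.coeFn_sub, Pi.sub_apply, lp.coeFn_smul, Pi.smul_apply]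
    by_cases hj : j = i
    · subst hj
      simp
    · rw [lp.single_apply_ne _ _ _ hj, smul_zero, sub_zero]
      exact lp.norm_apply_le_norm ENNReal.top_ne_zero x j

end Coordinates

section Preduals

/-- The embedding of an isometric predual `(Y, φ)` of `X` into the dual of `X`. -/
noncomputable def predualEmbedding {𝕜 X Y : Type*} [RCLike 𝕜] [NormedAddCommGroup X]
    [NormedSpace 𝕜 X] [NormedAddCommGroup Y] [NormedSpace 𝕜 Y] (φ : X ≃ₗᵢ[𝕜] StrongDual 𝕜 Y) :
    Y →ₗᵢ[𝕜] StrongDual 𝕜 X where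
  toLinearMap := (strongDualMap (φ.toContinuousLinearEquiv : X →L[𝕜] StrongDual 𝕜 Y)).toLinearMap
    ∘ₗ (NormedSpace.inclusionInDoubleDual 𝕜 Y).toLinearMap
  norm_map' y :=
    (ContinuousLinearMap.opNorm_comp_linearIsometryEquiv _ φ).trans
      ((NormedSpace.inclusionInDoubleDualLi 𝕜).norm_map y)

@[simp]
theorem predualEmbedding_apply {𝕜 X Y : Type*} [RCLike 𝕜] [NormedAddCommGroup X]
    [NormedSpace 𝕜 X] [NormedAddCommGroup Y] [NormedSpace 𝕜 Y] (φ : X ≃ₗᵢ[𝕜] StrongDual 𝕜 Y)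
    (y : Y) (x : X) : predualEmbedding φ y x = φ x y :=
  rfl

variable {ι : Type*} {Y : Type*} [NormedAddCommGroup Y] [NormedSpace ℂ Y] [CompleteSpace Y]

theorem isClosed_range_predualEmbedding {X : Type*} [NormedAddCommGroup X] [NormedSpace ℂ X]
    (φ : X ≃ₗᵢ[ℂ] StrongDual ℂ Y) :
    IsClosed ((predualEmbedding φ).toLinearMap.range : Set (StrongDual ℂ X)) := by
  rw [LinearMap.coe_range]
  exact (predualEmbedding φ).isometry.isClosedEmbedding.isClosed_range

theorem linftyCoord_mem_range (φ : lp (fun _ : ι => ℂ) ∞ ≃ₗᵢ[ℂ] StrongDual ℂ Y) (i : ι) :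
    linftyCoord i ∈ (predualEmbedding φ).toLinearMap.range := by
  classical
  rw [← SetLike.mem_coe, ← (isClosed_range_predualEmbedding φ).closure_eq, Metric.mem_closure_iff]
  intro ε hε
  have hnorm : ‖φ (lp.single ∞ i 1)‖ = 1 := by
    rw [φ.norm_map, lp.norm_single ENNReal.zero_lt_top, norm_one]
  -- With `‖y‖ < 1` and `(1 + ε)‖c‖ > 1`, the error after dividing by `c` is at most `(‖y‖ - ‖c‖) /
  -- ‖c‖ < ε`.
  obtain ⟨y, hy, hlt⟩ := (φ (lp.single ∞ i 1)).exists_lt_apply_of_lt_opNorm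
    (r := (1 + ε)⁻¹) (by rw [hnorm]; exact inv_lt_one_of_one_lt₀ (by linarith))
  set c := φ (lp.single ∞ i 1) y with hc
  have hcpos : 0 < ‖c‖ := lt_trans (by positivity) hlt
  have hc0 : c ≠ 0 := norm_pos_iff.1 hcpos
  refine ⟨_, ⟨c⁻¹ • y, rfl⟩, ?_⟩
  have key := norm_sub_smul_linftyCoord_le (predualEmbedding φ y) i
  rw [predualEmbedding_apply, ← hc, LinearIsometry.norm_map] at key
  have heq : predualEmbedding φ (c⁻¹ • y) - linftyCoord i =
      c⁻¹ • (predualEmbedding φ y - c • linftyCoord i) := by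
    rw [map_smul, smul_sub, inv_smul_smul₀ hc0]
  rw [dist_comm, dist_eq_norm]
  change ‖predualEmbedding φ (c⁻¹ • y) - linftyCoord i‖ < ε
  rw [heq, norm_smul, norm_inv, inv_mul_lt_iff₀ hcpos]
  have := (inv_lt_iff_one_lt_mul₀ (by positivity)).1 hlt
  linarith

theorem range_predualEmbedding (φ : lp (fun _ : ι => ℂ) ∞ ≃ₗᵢ[ℂ] StrongDual ℂ Y) :
    (predualEmbedding φ).toLinearMap.range = coordSpan ι := by
  apply le_antisymm
  · rintro _ ⟨y, rfl⟩
    by_contra hy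
    obtain ⟨f, hf, hfy⟩ := exists_strongDual_eq_zero_of_notMem
      ((coordSpan ι).comap (predualEmbedding φ).toLinearMap)
      ((Submodule.isClosed_topologicalClosure _).preimage (predualEmbedding φ).continuous) hy
    -- The separating functional is itself an element `x` of `ℓ^∞`, and vanishing on the preimage of
    -- each `δ_i` kills every coordinate of `x`.
    obtain ⟨x, rfl⟩ := φ.surjective f
    have hx : x = 0 := by
      ext i
      obtain ⟨z, hz⟩ := linftyCoord_mem_range φ i
      have h := hf z (by
        rw [Submodule.mem_comap, hz]
        exact linftyCoord_mem_coordSpan i)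
      rw [← predualEmbedding_apply] at h
      change (predualEmbedding φ).toLinearMap z x = 0 at h
      rw [hz] at h
      exact h
    exact hfy (by rw [hx, map_zero, zero_apply])
  · refine Submodule.topologicalClosure_minimal _ ?_ (isClosed_range_predualEmbedding φ)
    rw [Submodule.span_le]
    rintro _ ⟨i, rfl⟩
    exact linftyCoord_mem_range φ i

end Preduals

/-- A complete subspace `M` of a space `E` paired with `X` is an isometric predual of `X` if it is
norming and if every functional on `E` agrees on `M` with an element of `X`. -/
theorem isIsometricDualBanachSpace_of_norming {𝕜 : Type} {X E : Type u} [RCLike 𝕜]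
    [NormedAddCommGroup X] [NormedSpace 𝕜 X] [NormedAddCommGroup E] [NormedSpace 𝕜 E]
    (J : X →L[𝕜] StrongDual 𝕜 E) (M : Submodule 𝕜 E) (hM : IsComplete (M : Set E))
    (hJ : ∀ x, ‖J x‖ ≤ ‖x‖)
    (hnorm : ∀ (x : X) (C : ℝ), 0 ≤ C → (∀ F ∈ M, ‖J x F‖ ≤ C * ‖F‖) → ‖x‖ ≤ C)
    (heval : ∀ g : StrongDual 𝕜 E, ∃ x : X, ∀ F ∈ M, g F = J x F) :
    IsIsometricDualBanachSpace 𝕜 X := by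
  have hcomplete : CompleteSpace M := hM.completeSpace_coe
  let T : X →L[𝕜] StrongDual 𝕜 M := (strongDualMap M.subtypeL).comp J
  have hT (x : X) : ‖T x‖ = ‖x‖ := by
    apply le_antisymm
    · refine ContinuousLinearMap.opNorm_le_bound _ (norm_nonneg x) fun F => ?_
      exact ((J x).le_opNorm F).trans (mul_le_mul_of_nonneg_right (hJ x) (norm_nonneg _))
    · exact hnorm x _ (norm_nonneg _) fun F hF => (T x).le_opNorm ⟨F, hF⟩
  refine ⟨M, inferInstance, inferInstance, hcomplete, ⟨LinearIsometryEquiv.ofSurjective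
    { toLinearMap := T.toLinearMap, norm_map' := hT } fun f => ?_⟩⟩
  obtain ⟨g, hg, -⟩ := exists_extension_norm_eq M f
  obtain ⟨x, hx⟩ := heval g
  refine ⟨x, ?_⟩
  ext F
  rw [← hg F, hx F F.2]
  rfl

theorem isIsometricDualBanachSpace_linfty {ι : Type u} :
    IsIsometricDualBanachSpace ℂ (lp (fun _ : ι => ℂ) ∞) := by
  refine isIsometricDualBanachSpace_of_norming
    (NormedSpace.inclusionInDoubleDual ℂ _) (coordSpan ι)
    (Submodule.isClosed_topologicalClosure _).isComplete
    (fun x => ((NormedSpace.inclusionInDoubleDualLi ℂ).norm_map x).le) (fun x C hC h => ?_) fun g => ?_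
  · exact lp.norm_le_of_forall_le hC fun i => (h _ (linftyCoord_mem_coordSpan i)).trans
      (mul_le_of_le_one_right hC (norm_linftyCoord_le i))
  · have hbdd : Memℓp (fun i : ι => g (linftyCoord i)) ∞ := by
      refine memℓp_infty ⟨‖g‖, ?_⟩
      rintro _ ⟨i, rfl⟩
      exact (g.le_opNorm _).trans (mul_le_of_le_one_right (norm_nonneg _) (norm_linftyCoord_le i))
    -- The sequence of values `g(δ_i)` represents `g` on the closed span, by linearity and
    -- continuity.
    let x : lp (fun _ : ι => ℂ) ∞ := ⟨_, hbdd⟩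
    have hle : coordSpan ι ≤ (g - NormedSpace.inclusionInDoubleDual ℂ _ x).ker := by
      refine Submodule.topologicalClosure_minimal _ ?_ (ContinuousLinearMap.isClosed_ker _)
      rw [Submodule.span_le]
      rintro _ ⟨i, rfl⟩
      exact sub_self (g (linftyCoord i))
    exact ⟨x, fun F hF => sub_eq_zero.1 (hle hF)⟩

/-- If the isometric preduals of `X` given by `ψ` and by `ψ` followed by `α` have the same image in
the dual of `X`, then `α` is the dual map of an isometric isomorphism. -/
theorem exists_strongDualMap_eq {𝕜 X Y Z : Type*} [RCLike 𝕜]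
    [NormedAddCommGroup X] [NormedSpace 𝕜 X] [NormedAddCommGroup Y] [NormedSpace 𝕜 Y]
    [NormedAddCommGroup Z] [NormedSpace 𝕜 Z] (ψ : X ≃ₗᵢ[𝕜] StrongDual 𝕜 Z)
    (α : StrongDual 𝕜 Z ≃ₗᵢ[𝕜] StrongDual 𝕜 Y)
    (h : (predualEmbedding (ψ.trans α)).toLinearMap.range =
      (predualEmbedding ψ).toLinearMap.range) :
    ∃ l : Y ≃ₗᵢ[𝕜] Z,
      strongDualMap (l.toContinuousLinearEquiv : Y →L[𝕜] Z) =
        (α.toContinuousLinearEquiv : StrongDual 𝕜 Z →L[𝕜] StrongDual 𝕜 Y) := by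
  let l : Y ≃ₗᵢ[𝕜] Z := ((predualEmbedding (ψ.trans α)).equivRange.trans
    (LinearIsometryEquiv.ofEq _ _ h)).trans (predualEmbedding ψ).equivRange.symm
  have hl (y : Y) : predualEmbedding ψ (l y) = predualEmbedding (ψ.trans α) y :=
    congrArg Subtype.val ((predualEmbedding ψ).equivRange.apply_symm_apply
      (LinearIsometryEquiv.ofEq _ _ h ((predualEmbedding (ψ.trans α)).equivRange y)))
  refine ⟨l, ?_⟩
  ext f y
  obtain ⟨x, rfl⟩ := ψ.surjective f
  exact DFunLike.congr_fun (hl y) x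

theorem mainTheorem11 :
    HasStronglyUniqueIsometricBanachPredual.{0, v, w} ℂ (lp (fun _ : ℕ => ℂ) ∞) := by
  refine ⟨isIsometricDualBanachSpace_linfty, fun Y _ _ _ Z _ _ _ _ ψ α => ?_⟩
  exact exists_strongDualMap_eq ψ α
    ((range_predualEmbedding (ψ.trans α)).trans (range_predualEmbedding ψ).symm)
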